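/- Let $m\ge 0$ and let $\mathcal L_t$, $t>0$, be a family of probability distributions on $\mathbb R$, $Z_t\sim\mathcal L_t$, with $EZ_t^{2m}<\infty$ for all $t>0$, closed under independent addition: if $Z_s\sim\mathcal L_s$ and $Z_t\sim\mathcal L_t$ are independent then $Z_s+Z_t\sim\mathcal L_{s+t}$. For every $t>0$ let $P_t^0,\dots,P_t^m$ be monic polynomials, $P_t^k$ of degree $k$, with $E[P_t^j(Z_t)P_t^k(Z_t)]=0$ for $j\ne k$ and $E[P_t^k(Z_t)^2]>0$, and put $$\alpha_t^{(k)}=\frac1{k!}E[Z_t^kP_t^k(Z_t)],\qquad 0\le k\le m.$$ Terminology. For a random variable $X$, a measurable function $P$ and $k\ge 0$, a random variable $Y$ has the $X$–$P$ biased distribution of order $k$ if $\alpha=\frac1{k!}E[P(X)X^k]>0$ and $E[P(X)F(X)]=\alpha\,E[F^{(k)}(Y)]$ for every $F:\mathbb R\to\mathbb R$ whose $k$-th derivative exists everywhere and is measurable and for which $E|P(X)F(X)|<\infty$ and $E|F^{(k)}(Y)|<\infty$. Let $\mathcal M_t^m$ be the set of random variables $X$ with $E|X|^j<\infty$ and $EX^j=EZ_t^j$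 for $0\le j\le 2m$. Let $n\ge1$, $\lambda_1,\dots,\lambda_n>0$ and $\lambda=\lambda_1+\dots+\lambda_n$, and suppose that for some real weights $c_{\mathbf m}$ the identity $$P_\lambda^m(x_1+\dots+x_n)=\sum_{|\mathbf m|=m}c_{\mathbf m}\prod_{i=1}^nP_{\lambda_i}^{m_i}(x_i)$$ holds for all $x_1,\dots,x_n\in\mathbb R$, where $\mathbf m=(m_1,\dots,m_n)$ ranges over the multi-indices of non-negative integers with $|\mathbf m|=m_1+\dots+m_n=m$. Then: (a) $\displaystyle \alpha_\lambda^{(m)}=\sum_{|\mathbf m|=m}c_{\mathbf m}\prod_{i=1}^n\alpha_{\lambda_i}^{(m_i)}$. (b) The numbers $\displaystyle p_{\mathbf m}=c_{\mathbf m}\,\frac{\prod_{i=1}^n\alpha_{\lambda_i}^{(m_i)}}{\alpha_\lambda^{(m)}}$, $|\mathbf m|=m$, are non-negative and sum to $1$. (c) Let $X_1,\dots,X_n$ be independent with $X_i\in\mathcal M_{\lambda_i}^m$, and $W=X_1+\dots+X_n$. For $1\le i\le n$ and $0\le k\le m$ let $(X_i)_{\lambda_i}^{(k)}$ be a random variable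 having the $X_i$–$P_{\lambda_i}^k$ biased distribution of order $k$, such that the $n$ families $\big((X_i)_{\lambda_i}^{(k)}\big)_{0\le k\le m}$, $i=1,\dots,n$, are independent of each other. Let $\mathbf I=(I_1,\dots,I_n)$ be a random multi-index, independent of all the variables $(X_i)_{\lambda_i}^{(k)}$, with $P(\mathbf I=\mathbf m)=p_{\mathbf m}$ for $|\mathbf m|=m$. Then $$W_\lambda^{(m)}=\sum_{i=1}^n(X_i)_{\lambda_i}^{(I_i)}$$ has the $W$–$P_\lambda^m$ biased distribution of order $m$. -/

import Mathlib

open MeasureTheory ProbabilityTheory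
open scoped Polynomial

/-- `F` belongs to the class of functions whose `m`-th derivative exists on all of `ℝ` and is
measurable. -/
def HasMeasurableDeriv (m : ℕ) (F : ℝ → ℝ) : Prop :=
  (∀ j < m, Differentiable ℝ (iteratedDeriv j F)) ∧ Measurable (iteratedDeriv m F)

/-- The normalizing constant `α = (m!)⁻¹ E[P(X) X ^ m]` of the order `m` transformation with
biasing function `P`; here `μ` is the law of `X`. -/
noncomputable def biasConst (m : ℕ) (P : ℝ → ℝ) (μ : Measure ℝ) : ℝ :=
  (m.factorial : ℝ)⁻¹ * ∫ x, P x * x ^ m ∂μ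

/-- The law `ν` is the `X-P` biased distribution of order `m`, where `μ` is the law of `X`:
`α > 0`, and `E[P(X) F(X)] = α E[F^{(m)}(Y)]`, `Y ∼ ν`, for every `F` whose `m`-th derivative
exists and is measurable and for which both expectations exist. -/
def IsBiased (m : ℕ) (P : ℝ → ℝ) (μ ν : Measure ℝ) : Prop :=
  0 < biasConst m P μ ∧
    ∀ F : ℝ → ℝ, HasMeasurableDeriv m F →
      Integrable (fun x => P x * F x) μ →
      Integrable (iteratedDeriv m F) ν →
      ∫ x, P x * F x ∂μ = biasConst m P μ * ∫ y, iteratedDeriv m F y ∂ν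

/-- The family of laws `L t`, `t > 0`, is closed under independent addition: if `Z₁ ∼ L s` and
`Z₂ ∼ L t` are independent, then `Z₁ + Z₂ ∼ L (s + t)`. -/
def ClosedUnderIndepAddition (L : ℝ → Measure ℝ) : Prop :=
  ∀ s t : ℝ, 0 < s → 0 < t → (L s).conv (L t) = L (s + t)

/-- `p 0, …, p m` are monic polynomials of degrees `0, …, m`, orthogonal with respect to `μ`, and
nonzero in `L²(μ)`. -/
structure IsMonicOrthogonal (m : ℕ) (μ : Measure ℝ) (p : ℕ → ℝ[X]) : Prop where
  monic : ∀ k ≤ m, (p k).Monic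
  natDegree_eq : ∀ k ≤ m, (p k).natDegree = k
  orthogonal : ∀ j ≤ m, ∀ k ≤ m, j ≠ k → ∫ x, (p j).eval x * (p k).eval x ∂μ = 0
  sq_pos : ∀ k ≤ m, 0 < ∫ x, (p k).eval x ^ 2 ∂μ

/-- The law `μ` has the same (finite) moments as `ρ` up to order `2 * k`. -/
def MomentsMatch (k : ℕ) (ρ μ : Measure ℝ) : Prop :=
  ∀ j ≤ 2 * k, Integrable (fun x : ℝ => x ^ j) μ ∧ ∫ x, x ^ j ∂μ = ∫ x, x ^ j ∂ρ

/-- `α_t^{(k)} = (k!)⁻¹ E[Z_t ^ k P_t^k(Z_t)]`, where `Z_t ∼ L t` and `P_t^k` is `P t k`. -/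
noncomputable def alpha (L : ℝ → Measure ℝ) (P : ℝ → ℕ → ℝ[X]) (t : ℝ) (k : ℕ) : ℝ :=
  (k.factorial : ℝ)⁻¹ * ∫ x, x ^ k * (P t k).eval x ∂(L t)

/-- The product of the constants `α` over the coordinates of a multi-index. -/
noncomputable def alphaMulti (L : ℝ → Measure ℝ) (P : ℝ → ℕ → ℝ[X]) {n : ℕ}
    (lam : Fin n → ℝ) (k : Fin n → ℕ) : ℝ :=
  ∏ i, alpha L P (lam i) (k i)

/-- The product polynomial `∏ i, P_{λ_i}^{k_i}(x_i)` of a multi-index. -/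
noncomputable def polyMulti (P : ℝ → ℕ → ℝ[X]) {n : ℕ}
    (lam : Fin n → ℝ) (k : Fin n → ℕ) (x : Fin n → ℝ) : ℝ :=
  ∏ i, (P (lam i) (k i)).eval (x i)

/-- The finite set of multi-indices `k = (k_1, …, k_n)` with `|k| = m`. -/
def multiIndices (n m : ℕ) : Finset (Fin n → ℕ) :=
  Finset.piAntidiag Finset.univ m

/-! For (a) and (b), take independent `Z_i ∼ L (lam i)`, whose sum has law `L (∑ i, lam i)`, and
pair a polynomial `Q` of degree at most `m` in the sum with `∏ P_{λ_i}^{k_i}(Z_i)`, `|k| = m`. In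
the multinomial expansion every monomial having some exponent below `k_i` is killed by
orthogonality, so only `∏ Z_i ^ k_i` survives and the pairing is `Q.coeff m * m! * ∏ α`
(`integral_eval_sum_mul_prod`). The choice `Q = X ^ m` gives the identity for the constants. The
choice `Q = P_λ^m`, expanded by the assumed identity, leaves `c_k` times a product of squared norms,
whence `c_k > 0`.

For (c), testing a biased law on exponentials gives `E[P(X) e^{itX}] = α (it)^m φ_Y(t)`. This
relation is multiplicative over independent summands, so the polynomial identity turns it into the
same relation for `W` and the mixture over `I`. Passing from exponentials to all admissible `F` goes
through existence and uniqueness (`IsOrthogonalPolynomial.isBiased_of_charFun`): some biased law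
exists, and the relation determines its characteristic function.

Existence rests on interpolation. An orthogonal `P` has `m` distinct real roots `r_i`
(`exists_nodal`). With `p_F` the interpolant of `F` at the roots, `P (F - p_F) = P² F[x, r_1, …,
r_m]`, and `E[P p_F] = 0`. By Hermite–Genocchi (`integral_dividedKernel`) the divided difference
averages `F^{(m)}` against a positive kernel, so mixing that kernel over `P² dμ` and dividing by `α`
gives the biased law. -/

/-! ### Divided differences and the Hermite–Genocchi formula -/

/-- The nodes `x 1, …, x (m + 1)` contracted towards `x 0` by the factor `u`. -/
def contractNodes (m : ℕ) (x : Fin (m + 2) → ℝ) (u : ℝ) : Fin (m + 1) → ℝ :=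
  fun i => x 0 + u * (x i.succ - x 0)

/-- The measure `u ^ m du` on `(0, 1]`. -/
noncomputable def powUnit (m : ℕ) : Measure ℝ :=
  (volume.restrict (Set.Ioc 0 1)).withDensity (fun u => ENNReal.ofReal (u ^ m))

instance (m : ℕ) : IsFiniteMeasure (powUnit m) := by
  refine isFiniteMeasure_withDensity_ofReal ?_
  refine Integrable.hasFiniteIntegral ?_
  exact ((continuous_pow m).integrableOn_Icc (a := (0 : ℝ)) (b := 1)).mono_set
    Set.Ioc_subset_Icc_self

lemma measurable_contractNodes (m : ℕ) :
    Measurable (fun p : (Fin (m + 2) → ℝ) × ℝ => contractNodes m p.1 p.2) := by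
  unfold contractNodes
  fun_prop

/-- The kernel of the Hermite–Genocchi formula: the divided difference of `F` at the nodes `x` is
the integral of the `m`-th derivative of `F` against `dividedKernel m x`. -/
noncomputable def dividedKernel : (m : ℕ) → Kernel (Fin (m + 1) → ℝ) ℝ
  | 0 => Kernel.deterministic (fun x => x 0) (by fun_prop)
  | m + 1 => (dividedKernel m) ∘ₖ
      ((Kernel.id ×ₖ Kernel.const _ (powUnit m)).map (fun p => contractNodes m p.1 p.2))

instance isFiniteKernel_dividedKernel (m : ℕ) : IsFiniteKernel (dividedKernel m) := by
  induction m with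
  | zero => unfold dividedKernel; infer_instance
  | succ m ih => unfold dividedKernel; infer_instance

lemma dividedKernel_succ_apply (m : ℕ) (x : Fin (m + 2) → ℝ) :
    dividedKernel (m + 1) x =
      (dividedKernel m) ∘ₘ ((powUnit m).map (contractNodes m x)) := by
  have hm := measurable_contractNodes m
  have h1 : Measurable (contractNodes m x) := hm.comp measurable_prodMk_left
  rw [dividedKernel, Kernel.comp_apply, Kernel.map_apply _ hm, Kernel.prod_apply,
    Kernel.id_apply, Kernel.const_apply, Measure.dirac_prod, Measure.map_map hm
    measurable_prodMk_left]
  rfl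

lemma integral_measure_comp {α β : Type*} [MeasurableSpace α] [MeasurableSpace β] {μ : Measure α}
    [SFinite μ] {κ : Kernel α β} [IsSFiniteKernel κ] {f : β → ℝ} (hf : Integrable f (κ ∘ₘ μ)) :
    ∫ y, f y ∂(κ ∘ₘ μ) = ∫ x, ∫ y, f y ∂(κ x) ∂μ := by
  rw [Measure.comp_eq_comp_const_apply] at hf ⊢
  rw [Kernel.integral_comp hf, Kernel.const_apply]

lemma integrable_powUnit_iff {m : ℕ} {g : ℝ → ℝ} :
    Integrable g (powUnit m) ↔ IntegrableOn (fun u => u ^ m * g u) (Set.Ioc 0 1) := by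
  unfold powUnit
  rw [integrable_withDensity_iff (by fun_prop) (by simp)]
  refine integrable_congr ?_
  filter_upwards [ae_restrict_mem measurableSet_Ioc] with u hu
  rw [ENNReal.toReal_ofReal (pow_nonneg hu.1.le m), mul_comm]

lemma integral_powUnit {m : ℕ} (g : ℝ → ℝ) :
    ∫ u, g u ∂(powUnit m) = ∫ u in Set.Ioc (0:ℝ) 1, u ^ m * g u := by
  unfold powUnit
  rw [integral_withDensity_eq_integral_toReal_smul (by fun_prop) (by simp)]
  refine integral_congr_ae ?_
  filter_upwards [ae_restrict_mem measurableSet_Ioc] with u hu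
  rw [ENNReal.toReal_ofReal (pow_nonneg hu.1.le m), smul_eq_mul]

lemma ae_powUnit_pos (m : ℕ) : ∀ᵐ u ∂(powUnit m), 0 < u := by
  refine (withDensity_absolutelyContinuous _ _).ae_le ?_
  filter_upwards [ae_restrict_mem measurableSet_Ioc] with u hu using hu.1

lemma nodalWeight_univ_succ (m : ℕ) (x : Fin (m + 1) → ℝ) (i : Fin m) :
    Lagrange.nodalWeight Finset.univ x i.succ =
      (x i.succ - x 0)⁻¹ * Lagrange.nodalWeight Finset.univ (fun j : Fin m => x j.succ) i := by
  unfold Lagrange.nodalWeight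
  have : (Finset.univ : Finset (Fin (m + 1))).erase i.succ =
      insert 0 ((Finset.univ.erase i).map ⟨Fin.succ, Fin.succ_injective _⟩) := by
    ext j
    refine Fin.cases ?_ (fun j => ?_) j
    · simp [Fin.succ_ne_zero, eq_comm]
    · simp [Fin.succ_ne_zero]
  rw [this, Finset.prod_insert (by simp), Finset.prod_map]
  rfl

lemma nodalWeight_univ_zero_eq_inv_prod (m : ℕ) (x : Fin (m + 1) → ℝ) :
    Lagrange.nodalWeight Finset.univ x 0 = (∏ j : Fin m, (x 0 - x j.succ))⁻¹ := by
  unfold Lagrange.nodalWeight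
  have : (Finset.univ : Finset (Fin (m + 1))).erase 0 =
      Finset.univ.map ⟨Fin.succ, Fin.succ_injective _⟩ := by
    ext j
    refine Fin.cases ?_ (fun j => ?_) j <;> simp [Fin.succ_ne_zero]
  rw [this, Finset.prod_map, Finset.prod_inv_distrib]
  rfl

/-- The divided difference of the constant `1` on at least two nodes vanishes: evaluate at `x 0` the
interpolant of `1` through the other nodes. -/
lemma nodalWeight_univ_zero (m : ℕ) (x : Fin (m + 2) → ℝ) (hx : Function.Injective x) :
    Lagrange.nodalWeight Finset.univ x 0 =
      - ∑ i : Fin (m + 1), Lagrange.nodalWeight Finset.univ x i.succ := by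
  have h0 : ∀ i ∈ (Finset.univ : Finset (Fin (m + 1))), x 0 ≠ x i.succ := fun i _ h =>
    Fin.succ_ne_zero i (hx h).symm
  have h := Lagrange.eval_interpolate_not_at_node (s := Finset.univ)
    (v := fun j : Fin (m + 1) => x j.succ) (x := x 0) 1 h0
  rw [Lagrange.interpolate_one (fun a _ b _ h => Fin.succ_injective _ (hx h)) ⟨0, by simp⟩,
    Polynomial.eval_one, Lagrange.eval_nodal] at h
  rw [nodalWeight_univ_zero_eq_inv_prod, inv_eq_of_mul_eq_one_right h.symm, ← Finset.sum_neg_distrib]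
  refine Finset.sum_congr rfl fun i _ => ?_
  rw [nodalWeight_univ_succ, Pi.one_apply, mul_one, ← neg_sub (x i.succ) (x 0), inv_neg]
  ring

/-- Each of the `m` node differences scales by `u`; the resulting `u ^ (-m)` is what the density of
`powUnit m` cancels. -/
lemma nodalWeight_contractNodes (m : ℕ) (x : Fin (m + 2) → ℝ) (u : ℝ) (i : Fin (m + 1)) :
    Lagrange.nodalWeight Finset.univ (contractNodes m x u) i =
      (u ^ m)⁻¹ * Lagrange.nodalWeight Finset.univ (fun j : Fin (m + 1) => x j.succ) i := by
  unfold Lagrange.nodalWeight contractNodes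
  have : ∀ j : Fin (m + 1), (x 0 + u * (x i.succ - x 0) - (x 0 + u * (x j.succ - x 0)))⁻¹ =
      u⁻¹ * (x i.succ - x j.succ)⁻¹ := fun j => by rw [← mul_inv]; congr 1; ring
  simp_rw [this, Finset.prod_mul_distrib]
  simp

lemma injective_contractNodes {m : ℕ} {x : Fin (m + 2) → ℝ} (hx : Function.Injective x) {u : ℝ}
    (hu : 0 < u) : Function.Injective (contractNodes m x u) := by
  intro i j h
  unfold contractNodes at h
  have h' : u * (x i.succ - x 0) = u * (x j.succ - x 0) := add_left_cancel h
  exact Fin.succ_injective _ (hx (sub_left_injective (mul_left_cancel₀ hu.ne' h')))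

lemma HasMeasurableDeriv.deriv {m : ℕ} {F : ℝ → ℝ} (hF : HasMeasurableDeriv (m + 1) F) :
    HasMeasurableDeriv m (deriv F) := by
  refine ⟨fun j hj => ?_, ?_⟩
  · rw [← iteratedDeriv_succ']; exact hF.1 _ (by omega)
  · rw [← iteratedDeriv_succ']; exact hF.2

lemma HasMeasurableDeriv.differentiable {m : ℕ} {F : ℝ → ℝ} (hF : HasMeasurableDeriv (m + 1) F) :
    Differentiable ℝ F := by
  simpa using hF.1 0 (by omega)

/-- The fundamental theorem of calculus needs only a derivative everywhere and its integrability,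
not its continuity. -/
lemma integral_deriv_segment {F : ℝ → ℝ} (hF : Differentiable ℝ F) {a b : ℝ} (hab : b - a ≠ 0)
    (hint : IntegrableOn (fun u : ℝ => deriv F (a + u * (b - a))) (Set.Ioc 0 1)) :
    ∫ u in Set.Ioc (0:ℝ) 1, deriv F (a + u * (b - a)) = (b - a)⁻¹ * (F b - F a) := by
  have h : ∀ u ∈ Set.uIcc (0:ℝ) 1, HasDerivAt (fun u : ℝ => (b - a)⁻¹ * F (a + u * (b - a)))
      (deriv F (a + u * (b - a))) u := by
    intro u _
    have h1 : HasDerivAt (fun u : ℝ => a + u * (b - a)) (b - a) u := by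
      simpa using ((hasDerivAt_id u).mul_const (b - a)).const_add a
    have h2 := (((hF _).hasDerivAt).comp u h1).const_mul (b - a)⁻¹
    refine h2.congr_deriv ?_
    rw [mul_comm (deriv F _), inv_mul_cancel_left₀ hab]
  rw [← intervalIntegral.integral_of_le zero_le_one,
    intervalIntegral.integral_eq_sub_of_hasDerivAt h
      ((intervalIntegrable_iff_integrableOn_Ioc_of_le zero_le_one).2 hint)]
  simp
  ring

/-- The Hermite–Genocchi formula, for functions whose `m`-th derivative exists everywhere and is
integrable with respect to the kernel. -/
theorem integral_dividedKernel (m : ℕ) : ∀ (F : ℝ → ℝ) (x : Fin (m + 1) → ℝ),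
    Function.Injective x → HasMeasurableDeriv m F →
    Integrable (iteratedDeriv m F) (dividedKernel m x) →
    ∫ y, iteratedDeriv m F y ∂(dividedKernel m x) =
      ∑ i, Lagrange.nodalWeight Finset.univ x i * F (x i) := by
  induction m with
  | zero =>
    intro F x _ hF _
    have hF' : Measurable F := by simpa using hF.2
    simp [dividedKernel, Kernel.deterministic_apply, Lagrange.nodalWeight,
      integral_dirac' _ _ hF'.stronglyMeasurable]
  | succ m ih =>
    intro F x hx hF hint
    have hc : Measurable (contractNodes m x) :=
      (measurable_contractNodes m).comp measurable_prodMk_left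
    rw [dividedKernel_succ_apply] at hint ⊢
    have hF' := hF.deriv
    simp only [iteratedDeriv_succ'] at hint ⊢
    -- Integrability against the mixture gives integrability against almost every component, which
    -- is what the induction hypothesis asks for.
    have hae : ∀ᵐ u ∂(powUnit m),
        Integrable (iteratedDeriv m (deriv F)) (dividedKernel m (contractNodes m x u)) :=
      ae_of_ae_map hc.aemeasurable ((Measure.integrable_comp_iff hint.1).1 hint).1
    have hseg : ∀ i : Fin (m + 1), IntegrableOn
        (fun u : ℝ => deriv F (x 0 + u * (x i.succ - x 0))) (Set.Ioc 0 1) := by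
      intro i
      -- With two nodes, `F'` is merely measurable and the hypothesis is exactly its integrability
      -- on the one segment; with more nodes, `F'` is differentiable, hence continuous.
      cases m with
      | zero =>
        have hi : i = 0 := Fin.fin_one_eq_zero i
        subst hi
        have h1 := hint
        simp only [dividedKernel, iteratedDeriv_zero, Measure.deterministic_comp_eq_map] at h1
        rw [integrable_map_measure h1.1
          (measurable_pi_apply _).aemeasurable, integrable_map_measure _ hc.aemeasurable,
          integrable_powUnit_iff] at h1
        · simpa [contractNodes] using h1
        · refine Measurable.aestronglyMeasurable ?_
          have : Measurable (deriv F) := by simpa using hF'.2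
          fun_prop
      | succ m =>
        have : Continuous (deriv F) := hF'.differentiable.continuous
        exact (Continuous.integrableOn_Icc (by fun_prop)).mono_set Set.Ioc_subset_Icc_self
    -- The recursion is `F[x_0, …, x_{m+1}] = ∫₀¹ u^m F'[y_1(u), …, y_{m+1}(u)] du` with `y_i(u) =
    -- x_0 + u (x_i - x_0)`.
    calc _ = ∫ u, ∫ y, iteratedDeriv m (deriv F) y ∂(dividedKernel m (contractNodes m x u))
          ∂(powUnit m) := by
          rw [integral_measure_comp hint, integral_map hc.aemeasurable]
          exact (hF'.2.stronglyMeasurable.integral_kernel).aestronglyMeasurable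
      _ = ∫ u, (∑ i, Lagrange.nodalWeight Finset.univ (contractNodes m x u) i *
            deriv F (contractNodes m x u i)) ∂(powUnit m) := by
          refine integral_congr_ae ?_
          filter_upwards [hae, ae_powUnit_pos m] with u hu hu0
          exact ih _ _ (injective_contractNodes hx hu0) hF' hu
      _ = ∫ u in Set.Ioc (0:ℝ) 1, ∑ i : Fin (m + 1),
            Lagrange.nodalWeight Finset.univ (fun j : Fin (m + 1) => x j.succ) i *
            deriv F (x 0 + u * (x i.succ - x 0)) := by
          rw [integral_powUnit]
          refine integral_congr_ae ?_
          filter_upwards [ae_restrict_mem measurableSet_Ioc] with u hu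
          rw [Finset.mul_sum]
          refine Finset.sum_congr rfl fun i _ => ?_
          rw [nodalWeight_contractNodes, ← mul_assoc, ← mul_assoc,
            mul_inv_cancel₀ (pow_pos hu.1 m).ne', one_mul]
          rfl
      _ = ∑ i : Fin (m + 1), Lagrange.nodalWeight Finset.univ x i.succ *
            (F (x i.succ) - F (x 0)) := by
          rw [integral_finsetSum _ fun i _ => (hseg i).const_mul _]
          refine Finset.sum_congr rfl fun i _ => ?_
          rw [integral_const_mul, integral_deriv_segment hF.differentiable
            (sub_ne_zero.2 fun h => Fin.succ_ne_zero i (hx h)) (hseg i), nodalWeight_univ_succ]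
          ring
      _ = _ := by
          rw [Fin.sum_univ_succ (n := m + 1), nodalWeight_univ_zero m x hx]
          simp_rw [mul_sub]
          rw [Finset.sum_sub_distrib, ← Finset.sum_mul]
          ring

/-! ### Orthogonal polynomials and their roots -/

lemma integrable_polynomial_eval {N : ℕ} {μ : Measure ℝ}
    (hμ : ∀ j ≤ N, Integrable (fun x : ℝ => x ^ j) μ) {Q : ℝ[X]} (hQ : Q.natDegree ≤ N) :
    Integrable (fun x => Q.eval x) μ := by
  simp_rw [Polynomial.eval_eq_sum_range]
  exact integrable_finsetSum _ fun j hj =>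
    (hμ j (by have := Finset.mem_range.1 hj; omega)).const_mul _

lemma Polynomial.eval_sign_of_no_root {P : ℝ[X]} (hP : ∀ x, P.eval x ≠ 0) :
    (∀ x, 0 ≤ P.eval x) ∨ ∀ x, P.eval x ≤ 0 := by
  by_contra! h
  obtain ⟨⟨a, ha⟩, b, hb⟩ := h
  obtain ⟨c, hc⟩ := mem_range_of_exists_le_of_exists_ge P.continuous ⟨a, ha.le⟩ ⟨b, hb.le⟩
  exact hP c hc

/-- Multiplying a real polynomial by the linear factors at some of its roots (those of odd
multiplicity) makes its sign constant. -/
lemma Polynomial.exists_finset_roots_sign (n : ℕ) : ∀ P : ℝ[X], P ≠ 0 → P.natDegree ≤ n →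
    ∃ S : Finset ℝ, S ⊆ P.roots.toFinset ∧
      ((∀ x, 0 ≤ P.eval x * ∏ a ∈ S, (x - a)) ∨ ∀ x, P.eval x * ∏ a ∈ S, (x - a) ≤ 0) := by
  induction n with
  | zero =>
    intro P hP hn
    refine ⟨∅, by simp, ?_⟩
    simp only [Finset.prod_empty, mul_one]
    refine Polynomial.eval_sign_of_no_root fun x hx => hP ?_
    rw [Polynomial.eq_C_of_natDegree_le_zero hn] at hx ⊢
    simpa using hx
  | succ n ih =>
    intro P hP hn
    by_cases hr : ∃ r, P.eval r = 0
    · obtain ⟨r, hr⟩ := hr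
      obtain ⟨P', rfl⟩ := Polynomial.dvd_iff_isRoot.2 hr
      have hP' : P' ≠ 0 := right_ne_zero_of_mul hP
      rw [Polynomial.natDegree_mul (Polynomial.X_sub_C_ne_zero r) hP',
        Polynomial.natDegree_X_sub_C] at hn
      obtain ⟨S, hS, hs⟩ := ih P' hP' (by omega)
      -- The extra root flips the parity of the multiplicity of `r`, so membership of `r` in `S` is
      -- toggled; the product is then unchanged or gains a square.
      by_cases hrS : r ∈ S
      · refine ⟨S.erase r, fun a ha => ?_, ?_⟩
        · have := hS (Finset.mem_of_mem_erase ha)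
          rw [Multiset.mem_toFinset, Polynomial.mem_roots'] at this ⊢
          exact ⟨hP, by simp [this.2.eq_zero]⟩
        · have : ∀ x, ((Polynomial.X - Polynomial.C r) * P').eval x * ∏ a ∈ S.erase r, (x - a) =
              P'.eval x * ∏ a ∈ S, (x - a) := fun x => by
            rw [← Finset.mul_prod_erase S _ hrS]; simp; ring
          simpa only [this] using hs
      · refine ⟨insert r S, fun a ha => ?_, ?_⟩
        · rw [Multiset.mem_toFinset, Polynomial.mem_roots']
          refine ⟨hP, ?_⟩
          rcases Finset.mem_insert.1 ha with rfl | ha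
          · simp
          · have := hS ha
            rw [Multiset.mem_toFinset, Polynomial.mem_roots'] at this
            simp [this.2.eq_zero]
        · have : ∀ x, ((Polynomial.X - Polynomial.C r) * P').eval x * ∏ a ∈ insert r S, (x - a) =
              (x - r) ^ 2 * (P'.eval x * ∏ a ∈ S, (x - a)) := fun x => by
            rw [Finset.prod_insert hrS]; simp; ring
          simp only [this]
          exact hs.imp (fun h x => mul_nonneg (sq_nonneg _) (h x))
            fun h x => mul_nonpos_of_nonneg_of_nonpos (sq_nonneg _) (h x)
    · push Not at hr
      exact ⟨∅, by simp, by simpa using Polynomial.eval_sign_of_no_root hr⟩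

/-- `P` is monic of degree `m`, orthogonal to all polynomials of lower degree and nonzero in
`L²(μ)`, and `μ` has finite moments up to order `2 * m`. -/
structure IsOrthogonalPolynomial (m : ℕ) (P : ℝ[X]) (μ : Measure ℝ) : Prop where
  monic : P.Monic
  natDegree_eq : P.natDegree = m
  integrable_pow : ∀ j ≤ 2 * m, Integrable (fun x : ℝ => x ^ j) μ
  orthogonal : ∀ Q : ℝ[X], Q.degree < m → ∫ x, P.eval x * Q.eval x ∂μ = 0
  sq_pos : 0 < ∫ x, P.eval x ^ 2 ∂μ

namespace IsOrthogonalPolynomial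

variable {m : ℕ} {P : ℝ[X]} {μ : Measure ℝ}

lemma integrable_mul (h : IsOrthogonalPolynomial m P μ) {Q : ℝ[X]} (hQ : Q.natDegree ≤ m) :
    Integrable (fun x => P.eval x * Q.eval x) μ := by
  have := integrable_polynomial_eval h.integrable_pow (Q := P * Q)
    (Polynomial.natDegree_mul_le.trans (by rw [h.natDegree_eq]; omega))
  simpa using this

lemma integrable (h : IsOrthogonalPolynomial m P μ) : Integrable (fun x => P.eval x) μ := by
  simpa using h.integrable_mul (Q := 1) (by simp)

/-- Both `X ^ m` and `P` are monic of degree `m`, so their difference has lower degree and is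
orthogonal to `P`. -/
lemma integral_mul_pow (h : IsOrthogonalPolynomial m P μ) :
    ∫ x, P.eval x * x ^ m ∂μ = ∫ x, P.eval x ^ 2 ∂μ := by
  have hd : (Polynomial.X ^ m - P : ℝ[X]).degree < m := by
    have := Polynomial.degree_sub_lt_left (p := (Polynomial.X ^ m : ℝ[X])) (q := P)
      (by rw [Polynomial.degree_X_pow, Polynomial.degree_eq_natDegree h.monic.ne_zero,
        h.natDegree_eq]) (Polynomial.monic_X_pow m).ne_zero
      (by rw [(Polynomial.monic_X_pow m).leadingCoeff, h.monic.leadingCoeff])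
    rwa [Polynomial.degree_X_pow] at this
  have h0 := h.orthogonal _ hd
  have hX := h.integrable_mul (Q := Polynomial.X ^ m) (by simp)
  have hP := h.integrable_mul (Q := P) h.natDegree_eq.le
  simp only [Polynomial.eval_sub, mul_sub, Polynomial.eval_pow, Polynomial.eval_X] at h0 hX
  rw [integral_sub hX hP, sub_eq_zero] at h0
  rw [h0]
  simp_rw [sq]

/-- If `P` changed sign at fewer than `m` roots, the product `Q` of the corresponding linear factors
would be orthogonal to `P`. As `P Q` has constant sign, it would vanish almost everywhere, and so
would `P`, since the roots of `Q` are roots of `P`; this contradicts the positive norm. -/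
lemma exists_nodal (h : IsOrthogonalPolynomial m P μ) :
    ∃ r : Fin m → ℝ, Function.Injective r ∧ P = Lagrange.nodal Finset.univ r := by
  obtain ⟨S, hS, hs⟩ := Polynomial.exists_finset_roots_sign m P h.monic.ne_zero h.natDegree_eq.le
  set Q := Lagrange.nodal S id with hQ
  have hQe : ∀ x, Q.eval x = ∏ a ∈ S, (x - a) := fun x => by simp [hQ, Lagrange.eval_nodal]
  have hle : S.val ≤ P.roots := by
    rw [Multiset.le_iff_subset S.nodup]
    intro a ha
    exact Multiset.mem_toFinset.1 (hS ha)
  have hcard : m ≤ S.card := by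
    by_contra! hlt
    have h0 := h.orthogonal Q (by rw [hQ, Lagrange.degree_nodal]; exact_mod_cast hlt)
    have hint := h.integrable_mul (Q := Q) (by rw [hQ, Lagrange.natDegree_nodal]; exact hlt.le)
    have hz : ∀ᵐ x ∂μ, P.eval x * Q.eval x = 0 := by
      simp_rw [← hQe] at hs
      rcases hs with hs | hs
      · exact (integral_eq_zero_iff_of_nonneg hs hint).1 h0
      · have h1 : ∫ x, -(P.eval x * Q.eval x) ∂μ = 0 := by rw [integral_neg, h0, neg_zero]
        have := (integral_eq_zero_iff_of_nonneg (fun x => neg_nonneg.2 (hs x)) hint.neg).1 h1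
        filter_upwards [this] with x hx using neg_eq_zero.1 hx
    have : ∫ x, P.eval x ^ 2 ∂μ = 0 := by
      refine integral_eq_zero_of_ae ?_
      filter_upwards [hz] with x hx
      rcases mul_eq_zero.1 hx with hx | hx
      · simp [hx]
      · rw [hQe, Finset.prod_eq_zero_iff] at hx
        obtain ⟨a, ha, hxa⟩ := hx
        have := Polynomial.isRoot_of_mem_roots (Multiset.mem_toFinset.1 (hS ha))
        rw [sub_eq_zero.1 hxa]
        simp [this.eq_zero]
    exact h.sq_pos.ne' this
  have hroots : S.val = P.roots := Multiset.eq_of_le_of_card_le hle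
    ((Polynomial.card_roots' P).trans (h.natDegree_eq.trans_le hcard))
  have hSm : S.card = m := le_antisymm ((Multiset.card_le_card hle).trans
    ((Polynomial.card_roots' P).trans h.natDegree_eq.le)) hcard
  refine ⟨S.orderEmbOfFin hSm, (S.orderEmbOfFin hSm).injective, ?_⟩
  rw [← Polynomial.prod_multiset_X_sub_C_of_monic_of_roots_card_eq h.monic
    (by rw [← hroots, h.natDegree_eq]; exact hSm), ← hroots, Lagrange.nodal]
  have := Finset.prod_map Finset.univ (S.orderEmbOfFin hSm).toEmbedding
    (fun a => Polynomial.X - Polynomial.C a)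
  rw [Finset.map_orderEmbOfFin_univ] at this
  exact this

end IsOrthogonalPolynomial

/-! ### Existence of biased distributions -/

/-- Newton's remainder formula `F - p_F = P · F[x, r_1, …, r_m]`, multiplied by `P`. -/
lemma sq_mul_sum_nodalWeight {m : ℕ} {r : Fin m → ℝ} (F : ℝ → ℝ) {x : ℝ}
    (hx : (Lagrange.nodal Finset.univ r).eval x ≠ 0) :
    (Lagrange.nodal Finset.univ r).eval x ^ 2 *
      ∑ i, Lagrange.nodalWeight Finset.univ (Fin.cons x r : Fin (m + 1) → ℝ) i *
        F ((Fin.cons x r : Fin (m + 1) → ℝ) i) =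
      (Lagrange.nodal Finset.univ r).eval x * F x -
        (Lagrange.nodal Finset.univ r).eval x *
          (Lagrange.interpolate Finset.univ r (fun i => F (r i))).eval x := by
  have hxr : ∀ i ∈ (Finset.univ : Finset (Fin m)), x ≠ r i := fun i hi h => hx (by
    rw [h]; exact Lagrange.eval_nodal_at_node hi)
  rw [Lagrange.eval_interpolate_not_at_node _ hxr, Fin.sum_univ_succ,
    nodalWeight_univ_zero_eq_inv_prod]
  simp only [nodalWeight_univ_succ, Fin.cons_zero, Fin.cons_succ]
  rw [← Lagrange.eval_nodal, mul_add, ← mul_assoc, sq, mul_assoc _ _ (_)⁻¹, mul_inv_cancel₀ hx,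
    mul_one, mul_assoc, sub_eq_add_neg, ← mul_neg, ← mul_neg, ← Finset.sum_neg_distrib]
  congr 3
  refine Finset.sum_congr rfl fun i _ => ?_
  rw [← neg_sub x (r i), inv_neg]
  ring

/-- An orthogonal polynomial is the biasing function of some biased distribution. -/
theorem IsOrthogonalPolynomial.exists_isBiased {m : ℕ} {P : ℝ[X]} {μ : Measure ℝ}
    [IsFiniteMeasure μ] (h : IsOrthogonalPolynomial m P μ) :
    ∃ ν : Measure ℝ, IsFiniteMeasure ν ∧ IsBiased m (fun x => P.eval x) μ ν := by
  obtain ⟨r, hr, hP⟩ := h.exists_nodal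
  have hα : 0 < biasConst m (fun x => P.eval x) μ := by
    unfold biasConst
    rw [h.integral_mul_pow]
    have := h.sq_pos
    positivity
  set α := biasConst m (fun x => P.eval x) μ with hαdef
  have hcons : Measurable (fun x : ℝ => (Fin.cons x r : Fin (m + 1) → ℝ)) := by
    refine measurable_pi_iff.2 (Fin.cases ?_ fun i => ?_)
    · simpa using measurable_id'
    · simp
  set κ : Kernel ℝ ℝ := (dividedKernel m).comap _ hcons
  have hPm : Measurable (fun x => P.eval x) := P.continuous.measurable
  set ρ : Measure ℝ := μ.withDensity (fun x => ENNReal.ofReal (P.eval x ^ 2))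
  have hρ : IsFiniteMeasure ρ := by
    refine isFiniteMeasure_withDensity_ofReal (Integrable.hasFiniteIntegral ?_)
    simpa [sq] using h.integrable_mul h.natDegree_eq.le
  refine ⟨ENNReal.ofReal α⁻¹ • (κ ∘ₘ ρ), ?_, hα, fun F hF hPF hint => ?_⟩
  · exact Measure.smul_finite _ ENNReal.ofReal_ne_top
  · rw [integrable_smul_measure (by simpa using hα) ENNReal.ofReal_ne_top] at hint
    rw [integral_smul_measure, ENNReal.toReal_ofReal (inv_pos.2 hα).le, smul_eq_mul,
      mul_inv_cancel_left₀ hα.ne', integral_measure_comp hint,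
      integral_withDensity_eq_integral_toReal_smul (by fun_prop) (by simp)]
    have hae := ((Measure.integrable_comp_iff hint.1).1 hint).1
    rw [ae_withDensity_iff (by fun_prop)] at hae
    have hdeg := Lagrange.degree_interpolate_lt (s := Finset.univ) (fun i => F (r i)) hr.injOn
    rw [Finset.card_univ, Fintype.card_fin] at hdeg
    have hsub := integral_sub hPF (h.integrable_mul
      (Polynomial.natDegree_le_of_degree_le hdeg.le))
    rw [h.orthogonal _ hdeg, sub_zero] at hsub
    rw [← hsub]
    refine integral_congr_ae ?_
    filter_upwards [hae] with x hx
    rw [ENNReal.toReal_ofReal (sq_nonneg _), smul_eq_mul]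
    -- At a root of `P` both sides vanish; elsewhere `x` and the roots are distinct nodes and
    -- Hermite–Genocchi applies.
    by_cases hx0 : P.eval x = 0
    · simp [hx0]
    · have hinj : Function.Injective (Fin.cons x r : Fin (m + 1) → ℝ) := by
        refine Fin.cons_injective_iff.2 ⟨?_, hr⟩
        rintro ⟨i, rfl⟩
        exact hx0 (by rw [hP]; exact Lagrange.eval_nodal_at_node (Finset.mem_univ i))
      have hi := hx (by simpa using hx0)
      rw [Kernel.comap_apply] at hi ⊢
      rw [integral_dividedKernel m F _ hinj hF hi]
      rw [hP] at hx0 ⊢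
      exact (sq_mul_sum_nodalWeight F hx0).symm

/-! ### Characteristic functions of biased distributions -/

/-- Test functions are real-valued, so the exponential enters through `Re (z e^{itx})`; a general
`z` keeps the induction closed and covers real and imaginary parts at once. -/
lemma iteratedDeriv_re_mul_cexp (t : ℝ) (k : ℕ) : ∀ z : ℂ,
    iteratedDeriv k (fun x : ℝ => (z * Complex.exp (t * x * Complex.I)).re) =
      fun x : ℝ => (z * (t * Complex.I) ^ k * Complex.exp (t * x * Complex.I)).re := by
  induction k with
  | zero => simp
  | succ k ih =>
    intro z
    have hd : deriv (fun x : ℝ => (z * Complex.exp (t * x * Complex.I)).re) =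
        fun x : ℝ => ((z * (t * Complex.I)) * Complex.exp (t * x * Complex.I)).re := by
      funext x
      have h1 : HasDerivAt (fun x : ℝ => (t * x * Complex.I : ℂ)) (t * Complex.I) x := by
        simpa using ((Complex.ofRealCLM.hasDerivAt (x := x)).const_mul (t : ℂ)).mul_const Complex.I
      have h2 := (h1.cexp).const_mul z
      have h3 := (Complex.reCLM.hasFDerivAt.comp_hasDerivAt x h2)
      refine h3.deriv.trans ?_
      simp only [Complex.reCLM_apply]
      congr 1
      ring
    rw [iteratedDeriv_succ', hd, ih]
    funext x
    congr 1
    ring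

lemma hasMeasurableDeriv_re_mul_cexp (t : ℝ) (k : ℕ) (z : ℂ) :
    HasMeasurableDeriv k (fun x : ℝ => (z * Complex.exp (t * x * Complex.I)).re) := by
  refine ⟨fun j _ => ?_, ?_⟩
  · rw [iteratedDeriv_re_mul_cexp]
    have hd : Differentiable ℝ (fun x : ℝ => (x : ℂ)) := Complex.ofRealCLM.differentiable
    exact Complex.reCLM.differentiable.comp
      ((((hd.const_mul (t : ℂ)).mul_const Complex.I).cexp).const_mul (z * (t * Complex.I) ^ j))
  · rw [iteratedDeriv_re_mul_cexp]
    fun_prop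

lemma integrable_mul_cexp {μ : Measure ℝ} {f : ℝ → ℝ} (hf : Integrable f μ) (t : ℝ) :
    Integrable (fun x : ℝ => (f x : ℂ) * Complex.exp (t * x * Complex.I)) μ := by
  refine hf.ofReal.mul_bdd (c := 1) (by fun_prop) (Filter.Eventually.of_forall fun x => ?_)
  rw [← Complex.ofReal_mul, Complex.norm_exp_ofReal_mul_I]

/-- The characteristic function of a biased distribution. -/
lemma IsBiased.integral_mul_cexp {m : ℕ} {P : ℝ → ℝ} {μ ν : Measure ℝ} [IsFiniteMeasure ν]
    (h : IsBiased m P μ ν) (hP : Integrable P μ) (t : ℝ) :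
    ∫ x, (P x : ℂ) * Complex.exp (t * x * Complex.I) ∂μ =
      biasConst m P μ * (t * Complex.I) ^ m * charFun ν t := by
  have h1 := integrable_mul_cexp hP t
  have h2 : Integrable (fun x : ℝ => Complex.exp (t * x * Complex.I)) ν := by
    simpa using integrable_mul_cexp (integrable_const (1 : ℝ)) t
  have key : ∀ z : ℂ, (z * ∫ x, (P x : ℂ) * Complex.exp (t * x * Complex.I) ∂μ).re =
      (z * (biasConst m P μ * (t * Complex.I) ^ m * charFun ν t)).re := by
    intro z
    have hl : ∀ x : ℝ, P x * (z * Complex.exp (t * x * Complex.I)).re =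
        Complex.reCLM (z * ((P x : ℂ) * Complex.exp (t * x * Complex.I))) := fun x => by
      rw [Complex.reCLM_apply, mul_left_comm, Complex.re_ofReal_mul]
    have hr : ∀ x : ℝ, (z * (t * Complex.I) ^ m * Complex.exp (t * x * Complex.I)).re =
        Complex.reCLM (z * (t * Complex.I) ^ m * Complex.exp (t * x * Complex.I)) := fun x => rfl
    have := h.2 (fun x : ℝ => (z * Complex.exp (t * x * Complex.I)).re)
      (hasMeasurableDeriv_re_mul_cexp t m z)
      (by simp_rw [hl]; exact Complex.reCLM.integrable_comp (h1.const_mul z))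
      (by
        rw [iteratedDeriv_re_mul_cexp]; simp_rw [hr]
        exact Complex.reCLM.integrable_comp (h2.const_mul _))
    rw [iteratedDeriv_re_mul_cexp] at this
    simp_rw [hl, hr] at this
    rw [Complex.reCLM.integral_comp_comm (h1.const_mul z),
      Complex.reCLM.integral_comp_comm (h2.const_mul _), integral_const_mul, integral_const_mul,
      Complex.reCLM_apply, Complex.reCLM_apply, ← charFun_apply_real,
      ← Complex.re_ofReal_mul] at this
    rw [this]
    congr 1
    ring
  apply Complex.ext
  · simpa using key 1
  · simpa using key (-Complex.I)

/-- A law whose characteristic function satisfies the relation of a biased distribution is one. -/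
lemma IsOrthogonalPolynomial.isBiased_of_charFun {m : ℕ} {P : ℝ[X]} {μ ν : Measure ℝ}
    [IsFiniteMeasure μ] [IsFiniteMeasure ν] (h : IsOrthogonalPolynomial m P μ)
    (hν : ∀ t : ℝ, ∫ x, ((P.eval x : ℝ) : ℂ) * Complex.exp (t * x * Complex.I) ∂μ =
      biasConst m (fun x => P.eval x) μ * (t * Complex.I) ^ m * charFun ν t) :
    IsBiased m (fun x => P.eval x) μ ν := by
  obtain ⟨ν', hfin, hb⟩ := h.exists_isBiased
  suffices ν = ν' by rwa [this]
  refine Measure.ext_of_charFun ?_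
  -- For `m > 0` the factor `(it)^m` vanishes at `t = 0`, so the characteristic functions are
  -- compared off `0` and then by continuity.
  refine Continuous.ext_on (dense_compl_singleton (0 : ℝ)) continuous_charFun continuous_charFun ?_
  intro t ht
  have := (hν t).symm.trans (hb.integral_mul_cexp h.integrable t)
  refine mul_left_cancel₀ (mul_ne_zero ?_ (pow_ne_zero m (mul_ne_zero ?_ Complex.I_ne_zero))) this
  · exact_mod_cast hb.1.ne'
  · exact_mod_cast ht

/-! ### Moments, orthogonality and sums of independent variables -/

lemma integrable_pow_of_integrable_pow_two_mul {m : ℕ} {μ : Measure ℝ} [IsFiniteMeasure μ]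
    (h : Integrable (fun x : ℝ => x ^ (2 * m)) μ) :
    ∀ j ≤ 2 * m, Integrable (fun x : ℝ => x ^ j) μ := by
  intro j hj
  refine ((integrable_const (1 : ℝ)).add h).mono' (by fun_prop)
    (Filter.Eventually.of_forall fun x => ?_)
  have h0 : x ^ (2 * m) = |x| ^ (2 * m) := by rw [pow_mul, pow_mul, sq_abs]
  rw [Pi.add_apply, h0, norm_pow, Real.norm_eq_abs]
  rcases le_total |x| 1 with hx | hx
  · exact (pow_le_one₀ (abs_nonneg x) hx).trans (le_add_of_nonneg_right (by positivity))
  · exact (pow_le_pow_right₀ hx hj).trans (le_add_of_nonneg_left zero_le_one)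

/-- There is no law at parameter `0`, so the induction runs over nonempty index sets, at the level
of characteristic functions. -/
lemma ClosedUnderIndepAddition.eq_map_sum_pi {L : ℝ → Measure ℝ} (hL : ClosedUnderIndepAddition L)
    (hprob : ∀ t : ℝ, 0 < t → IsProbabilityMeasure (L t)) {n : ℕ} (hn : 1 ≤ n) {lam : Fin n → ℝ}
    (hlam : ∀ i, 0 < lam i) :
    L (∑ i, lam i) = (Measure.pi fun i => L (lam i)).map (fun x => ∑ i, x i) := by
  have hi : ∀ i, IsProbabilityMeasure (L (lam i)) := fun i => hprob _ (hlam i)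
  have hne : (Finset.univ : Finset (Fin n)).Nonempty := ⟨⟨0, hn⟩, by simp⟩
  have key : ∀ s : Finset (Fin n), s.Nonempty →
      charFun (L (∑ i ∈ s, lam i)) = ∏ i ∈ s, charFun (L (lam i)) := by
    intro s hs
    induction hs using Finset.Nonempty.cons_induction with
    | singleton i => simp
    | cons i s his hs ih =>
      have hpos : 0 < ∑ j ∈ s, lam j := Finset.sum_pos (fun j _ => hlam j) hs
      have := hprob _ hpos
      rw [Finset.sum_cons, Finset.prod_cons, ← ih, ← hL _ _ (hlam i) hpos]
      funext t
      rw [charFun_conv, Pi.mul_apply]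
  have := hprob _ (Finset.sum_pos (fun j _ => hlam j) hne)
  have hm : AEMeasurable (fun x : Fin n → ℝ => ∑ i, x i) (Measure.pi fun i => L (lam i)) := by
    fun_prop
  have := Measure.isProbabilityMeasure_map hm
  refine Measure.ext_of_charFun ?_
  rw [key _ hne, charFun_map_sum_pi_eq_prod]

/-- Mutual orthogonality extends to all lower-degree polynomials by successively subtracting the
leading coefficient times the monic `p d`. -/
lemma IsMonicOrthogonal.isOrthogonalPolynomial {m : ℕ} {μ : Measure ℝ} {p : ℕ → ℝ[X]}
    (h : IsMonicOrthogonal m μ p) (hμ : ∀ j ≤ 2 * m, Integrable (fun x : ℝ => x ^ j) μ) {k : ℕ}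
    (hk : k ≤ m) : IsOrthogonalPolynomial k (p k) μ := by
  refine ⟨h.monic k hk, h.natDegree_eq k hk, fun j hj => hμ j (by omega), fun Q hQ => ?_,
    h.sq_pos k hk⟩
  have hint : ∀ R : ℝ[X], R.natDegree ≤ m → Integrable (fun x => (p k).eval x * R.eval x) μ := by
    intro R hR
    have := integrable_polynomial_eval hμ (Q := p k * R)
      (Polynomial.natDegree_mul_le.trans (by rw [h.natDegree_eq k hk]; omega))
    simpa using this
  have key : ∀ d ≤ k, ∀ R : ℝ[X], R.degree < d → ∫ x, (p k).eval x * R.eval x ∂μ = 0 := by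
    intro d
    induction d with
    | zero =>
      intro _ R hR
      have : R = 0 := by simpa using hR
      simp [this]
    | succ d ih =>
      intro hd R hR
      set S := R - Polynomial.C (R.coeff d) * p d with hSdef
      have hS : S.degree < d := by
        rw [Polynomial.degree_lt_iff_coeff_zero] at hR ⊢
        intro j hj
        rw [hSdef, Polynomial.coeff_sub, Polynomial.coeff_C_mul]
        rcases hj.eq_or_lt with rfl | hj
        · have := (h.monic d (by omega)).coeff_natDegree
          rw [h.natDegree_eq d (by omega)] at this
          rw [this]; ring
        · rw [hR j hj, Polynomial.coeff_eq_zero_of_natDegree_lt (p := p d)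
            (by rw [h.natDegree_eq d (by omega)]; exact hj)]
          ring
      have hR' : ∀ x, (p k).eval x * R.eval x =
          (p k).eval x * S.eval x + R.coeff d * ((p k).eval x * (p d).eval x) := by
        intro x
        simp only [hSdef, Polynomial.eval_sub, Polynomial.eval_mul, Polynomial.eval_C]
        ring
      simp_rw [hR']
      rw [integral_add (hint _ ((Polynomial.natDegree_le_of_degree_le hS.le).trans (by omega)))
        ((hint _ (by rw [h.natDegree_eq d (by omega)]; omega)).const_mul _), ih (by omega) S hS,
        integral_const_mul, h.orthogonal k hk d (by omega) (by omega)]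
      ring
  exact key k le_rfl Q hQ

lemma integral_sum_pow_mul_prod {n : ℕ} {μ : Fin n → Measure ℝ} [∀ i, IsProbabilityMeasure (μ i)]
    {g : Fin n → ℝ → ℝ} {d : ℕ} (hg : ∀ i, ∀ j ≤ d, Integrable (fun x => g i x * x ^ j) (μ i)) :
    Integrable (fun x : Fin n → ℝ => (∑ i, x i) ^ d * ∏ i, g i (x i)) (Measure.pi μ) ∧
      ∫ x, (∑ i, x i) ^ d * ∏ i, g i (x i) ∂(Measure.pi μ) =
        ∑ j ∈ Finset.piAntidiag Finset.univ d,
          (Nat.multinomial Finset.univ j : ℝ) * ∏ i, ∫ x, g i x * x ^ j i ∂(μ i) := by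
  have hexp : ∀ x : Fin n → ℝ, (∑ i, x i) ^ d * ∏ i, g i (x i) =
      ∑ j ∈ Finset.piAntidiag Finset.univ d,
        (Nat.multinomial Finset.univ j : ℝ) * ∏ i, (g i (x i) * x i ^ j i) := by
    intro x
    rw [Finset.sum_pow_eq_sum_piAntidiag, Finset.sum_mul]
    refine Finset.sum_congr rfl fun j _ => ?_
    rw [mul_assoc, ← Finset.prod_mul_distrib]
    simp_rw [mul_comm]
  have hint : ∀ j ∈ Finset.piAntidiag (Finset.univ : Finset (Fin n)) d,
      Integrable (fun x : Fin n → ℝ => (Nat.multinomial Finset.univ j : ℝ) *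
        ∏ i, (g i (x i) * x i ^ j i)) (Measure.pi μ) := by
    intro j hj
    have hj' := (Finset.mem_piAntidiag.1 hj).1
    refine Integrable.const_mul (Integrable.fintype_prod_dep fun i => hg i (j i) ?_) _
    rw [← hj']
    exact Finset.single_le_sum (fun _ _ => Nat.zero_le _) (Finset.mem_univ i)
  simp_rw [hexp]
  refine ⟨integrable_finsetSum _ hint, ?_⟩
  rw [integral_finsetSum _ hint]
  refine Finset.sum_congr rfl fun j _ => ?_
  rw [integral_const_mul, integral_fintype_prod_eq_prod (fun i x => g i x * x ^ j i)]

/-- The moments of a sum of independent variables are determined by those of the summands. -/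
lemma MomentsMatch.map_sum_pi {m n : ℕ} {ρ μ : Fin n → Measure ℝ}
    [∀ i, IsProbabilityMeasure (ρ i)] [∀ i, IsProbabilityMeasure (μ i)]
    (hρ : ∀ i, ∀ j ≤ 2 * m, Integrable (fun x : ℝ => x ^ j) (ρ i))
    (h : ∀ i, MomentsMatch m (ρ i) (μ i)) :
    MomentsMatch m ((Measure.pi ρ).map fun x => ∑ i, x i) ((Measure.pi μ).map fun x => ∑ i, x i) := by
  intro d hd
  have h1 := integral_sum_pow_mul_prod (μ := ρ) (g := fun _ _ => 1) (d := d)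
    (fun i j hj => by simpa using hρ i j (by omega))
  have h2 := integral_sum_pow_mul_prod (μ := μ) (g := fun _ _ => 1) (d := d)
    (fun i j hj => by simpa using (h i j (by omega)).1)
  simp only [Finset.prod_const_one, mul_one, one_mul] at h1 h2
  rw [integrable_map_measure (by fun_prop) (by fun_prop), integral_map (by fun_prop) (by fun_prop),
    integral_map (by fun_prop) (by fun_prop), h1.2, h2.2]
  refine ⟨h2.1, Finset.sum_congr rfl fun j hj => ?_⟩
  have hj' := (Finset.mem_piAntidiag.1 hj).1
  congr 1
  refine Finset.prod_congr rfl fun i _ => (h i _ ?_).2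
  refine le_trans ?_ hd
  rw [← hj']
  exact Finset.single_le_sum (fun _ _ => Nat.zero_le _) (Finset.mem_univ i)

lemma MomentsMatch.integral_eval {m : ℕ} {ρ μ : Measure ℝ} (h : MomentsMatch m ρ μ)
    (hρ : ∀ j ≤ 2 * m, Integrable (fun x : ℝ => x ^ j) ρ) {Q : ℝ[X]} (hQ : Q.natDegree ≤ 2 * m) :
    ∫ x, Q.eval x ∂μ = ∫ x, Q.eval x ∂ρ := by
  simp_rw [Polynomial.eval_eq_sum_range]
  have hle : ∀ j ∈ Finset.range (Q.natDegree + 1), j ≤ 2 * m := fun j hj => by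
    have := Finset.mem_range.1 hj; omega
  rw [integral_finsetSum _ fun j hj => (h j (hle j hj)).1.const_mul _,
    integral_finsetSum _ fun j hj => (hρ j (hle j hj)).const_mul _]
  refine Finset.sum_congr rfl fun j hj => ?_
  rw [integral_const_mul, integral_const_mul, (h j (hle j hj)).2]

lemma IsOrthogonalPolynomial.integral_mul_eq {m k : ℕ} {P Q : ℝ[X]} {ρ μ : Measure ℝ} (hk : k ≤ m)
    (hP : IsOrthogonalPolynomial k P ρ) (h : MomentsMatch m ρ μ)
    (hρ : ∀ j ≤ 2 * m, Integrable (fun x : ℝ => x ^ j) ρ) (hQ : Q.natDegree ≤ m) :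
    ∫ x, P.eval x * Q.eval x ∂μ = ∫ x, P.eval x * Q.eval x ∂ρ := by
  have := h.integral_eval hρ (Q := P * Q)
    (Polynomial.natDegree_mul_le.trans (by rw [hP.natDegree_eq]; omega))
  simpa using this

/-- Orthogonality and the norm of `P` involve only moments up to order `2 * m`. -/
lemma IsOrthogonalPolynomial.of_momentsMatch {m : ℕ} {P : ℝ[X]} {ρ μ : Measure ℝ}
    (hP : IsOrthogonalPolynomial m P ρ) (h : MomentsMatch m ρ μ) :
    IsOrthogonalPolynomial m P μ := by
  refine ⟨hP.monic, hP.natDegree_eq, fun j hj => (h j hj).1, fun Q hQ => ?_, ?_⟩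
  · rw [hP.integral_mul_eq le_rfl h hP.integrable_pow
      (Polynomial.natDegree_le_of_degree_le hQ.le), hP.orthogonal Q hQ]
  · have := hP.integral_mul_eq le_rfl h hP.integrable_pow hP.natDegree_eq.le
    simp_rw [← sq] at this
    rw [this]
    exact hP.sq_pos

lemma IsOrthogonalPolynomial.biasConst_eq {m k : ℕ} {P : ℝ[X]} {ρ μ : Measure ℝ} (hk : k ≤ m)
    (hP : IsOrthogonalPolynomial k P ρ) (h : MomentsMatch m ρ μ)
    (hρ : ∀ j ≤ 2 * m, Integrable (fun x : ℝ => x ^ j) ρ) :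
    biasConst k (fun x => P.eval x) μ = (k.factorial : ℝ)⁻¹ * ∫ x, x ^ k * P.eval x ∂ρ := by
  have := hP.integral_mul_eq hk h hρ (Q := Polynomial.X ^ k) (by simpa using hk)
  simp only [Polynomial.eval_pow, Polynomial.eval_X] at this
  rw [biasConst, this]
  simp_rw [mul_comm]

/-- Pairing a polynomial in the sum of independent variables with a product of orthogonal
polynomials of total degree `m` extracts the coefficient of degree `m`. -/
lemma integral_eval_sum_mul_prod {m n : ℕ} {μ : Fin n → Measure ℝ}
    [∀ i, IsProbabilityMeasure (μ i)] (hμ : ∀ i, ∀ j ≤ 2 * m, Integrable (fun x : ℝ => x ^ j) (μ i))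
    {k : Fin n → ℕ} (hk : ∑ i, k i = m) {p : Fin n → ℝ[X]}
    (hp : ∀ i, IsOrthogonalPolynomial (k i) (p i) (μ i)) {Q : ℝ[X]} (hQ : Q.natDegree ≤ m) :
    Integrable (fun x : Fin n → ℝ => Q.eval (∑ i, x i) * ∏ i, (p i).eval (x i)) (Measure.pi μ) ∧
      ∫ x, Q.eval (∑ i, x i) * ∏ i, (p i).eval (x i) ∂(Measure.pi μ) =
        Q.coeff m * ((Nat.multinomial Finset.univ k : ℝ) *
          ∏ i, ∫ x, (p i).eval x * x ^ k i ∂(μ i)) := by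
  have hki : ∀ i, k i ≤ m := fun i => by
    rw [← hk]; exact Finset.single_le_sum (fun _ _ => Nat.zero_le _) (Finset.mem_univ i)
  have hpow : ∀ d ≤ m, ∀ i, ∀ j ≤ d, Integrable (fun x => (p i).eval x * x ^ j) (μ i) := by
    intro d hd i j hj
    have := integrable_polynomial_eval (hμ i) (Q := p i * Polynomial.X ^ j)
      (Polynomial.natDegree_mul_le.trans
        (by rw [(hp i).natDegree_eq, Polynomial.natDegree_X_pow]; have := hki i; omega))
    simpa using this
  have hzero : ∀ j : Fin n → ℕ, (∃ i, j i < k i) →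
      ∏ i, ∫ x, (p i).eval x * x ^ j i ∂(μ i) = 0 := by
    rintro j ⟨i, hi⟩
    refine Finset.prod_eq_zero (Finset.mem_univ i) ?_
    have := (hp i).orthogonal (Polynomial.X ^ j i)
      (by rw [Polynomial.degree_X_pow]; exact_mod_cast hi)
    simpa using this
  have hterm : ∀ d ∈ Finset.range (m + 1), Integrable (fun x : Fin n → ℝ =>
      Q.coeff d * ((∑ i, x i) ^ d * ∏ i, (p i).eval (x i))) (Measure.pi μ) := fun d hd =>
    (integral_sum_pow_mul_prod (g := fun i x => (p i).eval x)
      (hpow d (by have := Finset.mem_range.1 hd; omega))).1.const_mul _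
  have hexp : ∀ x : Fin n → ℝ, Q.eval (∑ i, x i) * ∏ i, (p i).eval (x i) =
      ∑ d ∈ Finset.range (m + 1), Q.coeff d * ((∑ i, x i) ^ d * ∏ i, (p i).eval (x i)) := by
    intro x
    rw [Polynomial.eval_eq_sum_range' (n := m + 1) (by omega), Finset.sum_mul]
    simp_rw [mul_assoc]
  simp_rw [hexp]
  refine ⟨integrable_finsetSum _ hterm, ?_⟩
  rw [integral_finsetSum _ hterm, Finset.sum_eq_single m]
  · rw [integral_const_mul, (integral_sum_pow_mul_prod (g := fun i x => (p i).eval x)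
      (hpow m le_rfl)).2, Finset.sum_eq_single k]
    -- If no exponent lies below `k`, then `k ≤ j` with equal sums forces `j = k`.
    · intro j hj hjk
      rw [hzero j, mul_zero]
      by_contra! hle
      refine hjk (funext fun i => ?_)
      have hj' := (Finset.mem_piAntidiag.1 hj).1
      exact (((Finset.sum_eq_sum_iff_of_le fun i _ => hle i).1 (hk.trans hj'.symm)) i
        (Finset.mem_univ i)).symm
    · intro h
      exact absurd (Finset.mem_piAntidiag.2 ⟨hk, fun i _ => Finset.mem_univ i⟩) h
  · intro d hd hdm
    have hd := Finset.mem_range.1 hd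
    rw [integral_const_mul, (integral_sum_pow_mul_prod (g := fun i x => (p i).eval x)
      (hpow d (by omega))).2, Finset.sum_eq_zero, mul_zero]
    intro j hj
    rw [hzero j, mul_zero]
    have hj' := (Finset.mem_piAntidiag.1 hj).1
    obtain ⟨i, _, hi⟩ := Finset.exists_lt_of_sum_lt (s := Finset.univ) (f := j) (g := k)
      (hj'.trans_lt ((by omega : d < m).trans_eq hk.symm))
    exact ⟨i, hi⟩
  · intro h
    exact absurd (Finset.mem_range.2 (by omega)) h

/-! ### Mixing over a random multi-index -/

/-- The characteristic function of a sum of variables with randomly chosen indices. -/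
lemma charFun_map_sum_random_index {Ω : Type*} [MeasurableSpace Ω] {μ : Measure Ω}
    [IsProbabilityMeasure μ] {n : ℕ} {Y : Fin n → ℕ → Ω → ℝ} {I : Ω → Fin n → ℕ}
    (hY : ∀ i k, Measurable (Y i k)) (hYind : iIndepFun (fun i ω k => Y i k ω) μ)
    (hI : Measurable I) (hIY : IndepFun I (fun ω i k => Y i k ω) μ) (S : Finset (Fin n → ℕ))
    (hS : ∑ k ∈ S, μ.real (I ⁻¹' {k}) = 1) (t : ℝ) :
    charFun (μ.map (fun ω => ∑ i, Y i (I ω i) ω)) t =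
      ∑ k ∈ S, (μ.real (I ⁻¹' {k}) : ℂ) * ∏ i, charFun (μ.map (Y i (k i))) t := by
  have hmeas : ∀ k : Fin n → ℕ, MeasurableSet (I ⁻¹' {k}) := fun k =>
    hI (measurableSet_singleton k)
  have hYI : Measurable (fun ω => ∑ i, Y i (I ω i) ω) := by
    refine Finset.measurable_sum _ fun i _ => ?_
    have h1 : Measurable (fun p : ℕ × Ω => Y i p.1 p.2) := measurable_from_prod_countable_right (hY i)
    exact h1.comp (((measurable_pi_apply i).comp hI).prodMk measurable_id)
  have hdisj : Set.PairwiseDisjoint (S : Set (Fin n → ℕ)) (fun k => I ⁻¹' {k}) := by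
    intro k _ l _ hkl
    exact Disjoint.preimage _ (Set.disjoint_singleton.2 hkl)
  -- The masses on `S` already sum to `1`, so `I` lies in `S` almost surely.
  have hfull : μ.restrict (⋃ k ∈ S, I ⁻¹' {k}) = μ := by
    refine Measure.restrict_eq_self_of_ae_mem ?_
    have hU : MeasurableSet (⋃ k ∈ S, I ⁻¹' {k}) := S.measurableSet_biUnion fun k _ => hmeas k
    refine (prob_compl_eq_zero_iff hU).2 ?_
    rw [← measureReal_biUnion_finset hdisj fun k _ => hmeas k] at hS
    rw [measureReal_def, ENNReal.toReal_eq_one_iff] at hS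
    exact hS
  have hbound : Integrable (fun ω => Complex.exp (t * ((∑ i, Y i (I ω i) ω : ℝ) : ℂ) * Complex.I))
      μ := by
    refine (integrable_const (1 : ℝ)).mono' (((Complex.measurable_ofReal.comp hYI).const_mul
      (t : ℂ)).mul_const Complex.I).cexp.aestronglyMeasurable (Filter.Eventually.of_forall fun ω => ?_)
    rw [← Complex.ofReal_mul, Complex.norm_exp_ofReal_mul_I]
  rw [charFun_apply_real, integral_map hYI.aemeasurable (by fun_prop), ← hfull,
    integral_biUnion_finset S (fun k _ => hmeas k) hdisj fun k _ => hbound.integrableOn, hfull]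
  refine Finset.sum_congr rfl fun k _ => ?_
  have hYk : ∀ i, AEMeasurable (Y i (k i)) μ := fun i => (hY i (k i)).aemeasurable
  have hind : iIndepFun (fun i => Y i (k i)) μ :=
    hYind.comp (fun i y => y (k i)) fun i => measurable_pi_apply _
  have hcf := congrFun (hind.charFun_map_fun_sum_eq_prod hYk) t
  rw [Finset.prod_apply, charFun_apply_real,
    integral_map (Finset.aemeasurable_fun_sum _ fun i _ => hYk i) (by fun_prop)] at hcf
  rw [← hcf, ← integral_indicator (hmeas k)]
  have hφ : Measurable (fun y : Fin n → ℕ → ℝ =>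
      Complex.exp (t * ((∑ i, y i (k i) : ℝ) : ℂ) * Complex.I)) := by fun_prop
  have hχ : Measurable (Set.indicator ({k} : Set (Fin n → ℕ)) (fun _ => (1 : ℂ))) :=
    measurable_const.indicator (measurableSet_singleton k)
  have hmul := (hIY.comp hχ hφ).integral_fun_mul_eq_mul_integral
    (hχ.comp hI).aestronglyMeasurable
    (hφ.comp (measurable_pi_iff.2 fun i => measurable_pi_iff.2 fun j => hY i j)).aestronglyMeasurable
  have hone : ∫ ω, Set.indicator ({k} : Set (Fin n → ℕ)) (fun _ => (1 : ℂ)) (I ω) ∂μ =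
      μ.real (I ⁻¹' {k}) := by
    have := integral_indicator_const (μ := μ) (1 : ℂ) (hmeas k)
    simp only [Complex.real_smul, mul_one] at this
    rw [← this]
    rfl
  simp only [Function.comp_apply] at hmul
  rw [hone] at hmul
  rw [← hmul]
  refine integral_congr_ae (Filter.Eventually.of_forall fun ω => ?_)
  by_cases h : I ω = k
  · have h' : ω ∈ I ⁻¹' {k} := h
    simp only [Set.indicator_of_mem h', h, Set.mem_singleton_iff, Set.indicator_of_mem, one_mul]
  · have h' : ω ∉ I ⁻¹' {k} := h
    simp only [Set.indicator_of_notMem h', Set.mem_singleton_iff, h, not_false_eq_true,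
      Set.indicator_of_notMem, zero_mul]

lemma le_of_mem_multiIndices {n m : ℕ} {k : Fin n → ℕ} (hk : k ∈ multiIndices n m) (i : Fin n) :
    k i ≤ m := by
  rw [← (Finset.mem_piAntidiag.1 hk).1]
  exact Finset.single_le_sum (fun _ _ => Nat.zero_le _) (Finset.mem_univ i)

/-! ### The main theorem -/

theorem theorem3p1
    (m : ℕ) (L : ℝ → Measure ℝ) (P : ℝ → ℕ → ℝ[X])
    (hprob : ∀ t : ℝ, 0 < t → IsProbabilityMeasure (L t))
    (hadd : ClosedUnderIndepAddition L)
    (hmom : ∀ t : ℝ, 0 < t → Integrable (fun x : ℝ => x ^ (2 * m)) (L t))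
    (hP : ∀ t : ℝ, 0 < t → IsMonicOrthogonal m (L t) (P t))
    (n : ℕ) (hn : 1 ≤ n) (lam : Fin n → ℝ) (hlam : ∀ i, 0 < lam i)
    (c : (Fin n → ℕ) → ℝ)
    (hident : ∀ x : Fin n → ℝ,
      (P (∑ i, lam i) m).eval (∑ i, x i) = ∑ k ∈ multiIndices n m, c k * polyMulti P lam k x) :
    -- the identity for the constants
    alpha L P (∑ i, lam i) m = ∑ k ∈ multiIndices n m, c k * alphaMulti L P lam k ∧
    -- the weights are a probability distribution on the multi-indices of size `m`
    (∀ k ∈ multiIndices n m, 0 ≤ c k * (alphaMulti L P lam k / alpha L P (∑ i, lam i) m)) ∧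
    ∑ k ∈ multiIndices n m, c k * (alphaMulti L P lam k / alpha L P (∑ i, lam i) m) = 1 ∧
    -- `Y i k` has the `X i`-biased distribution of order `k`, for `k ≤ m`
    -- (the variables `Y i k` with `k > m` play no role, and may be taken to be `0`)
    ∀ (Ω : Type*) [MeasurableSpace Ω] (μ : Measure Ω) [IsProbabilityMeasure μ]
      (X : Fin n → Ω → ℝ) (Y : Fin n → ℕ → Ω → ℝ) (I : Ω → Fin n → ℕ),
      (∀ i, Measurable (X i)) → iIndepFun X μ →
      (∀ i, MomentsMatch m (L (lam i)) (μ.map (X i))) →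
      (∀ i k, Measurable (Y i k)) →
      (∀ i, ∀ k ≤ m, IsBiased k (fun x => (P (lam i) k).eval x) (μ.map (X i)) (μ.map (Y i k))) →
      iIndepFun (fun i ω k => Y i k ω) μ →
      Measurable I →
      (∀ k ∈ multiIndices n m, μ.real (I ⁻¹' {k}) =
        c k * (alphaMulti L P lam k / alpha L P (∑ i, lam i) m)) →
      IndepFun I (fun ω i k => Y i k ω) μ →
      IsBiased m (fun x => (P (∑ i, lam i) m).eval x)
        (μ.map (fun ω => ∑ i, X i ω)) (μ.map (fun ω => ∑ i, Y i (I ω i) ω)) := by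
  have hLi : ∀ i, IsProbabilityMeasure (L (lam i)) := fun i => hprob _ (hlam i)
  have hpos : 0 < ∑ i, lam i := Finset.sum_pos (fun i _ => hlam i) ⟨⟨0, hn⟩, Finset.mem_univ _⟩
  have hLs := hprob _ hpos
  have hLmom : ∀ t : ℝ, 0 < t → ∀ j ≤ 2 * m, Integrable (fun x : ℝ => x ^ j) (L t) := fun t ht => by
    have := hprob t ht
    exact integrable_pow_of_integrable_pow_two_mul (hmom t ht)
  have hop : ∀ t : ℝ, 0 < t → ∀ k ≤ m, IsOrthogonalPolynomial k (P t k) (L t) := fun t ht k hk =>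
    (hP t ht).isOrthogonalPolynomial (hLmom t ht) hk
  have hα : ∀ t : ℝ, 0 < t → ∀ k ≤ m, 0 < alpha L P t k := fun t ht k hk => by
    unfold alpha
    simp_rw [mul_comm (_ ^ k)]
    rw [(hop t ht k hk).integral_mul_pow]
    have := (hop t ht k hk).sq_pos
    positivity
  have hsum := hadd.eq_map_sum_pi hprob hn hlam
  have hmi : ∀ k ∈ multiIndices n m, ∑ i, k i = m := fun k hk => (Finset.mem_piAntidiag.1 hk).1
  have hαM : ∀ k ∈ multiIndices n m, 0 < alphaMulti L P lam k := fun k hk =>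
    Finset.prod_pos fun i _ => hα _ (hlam i) _ (le_of_mem_multiIndices hk i)
  -- pairing with the product polynomials
  have hpair : ∀ k ∈ multiIndices n m, ∀ Q : ℝ[X], Q.natDegree ≤ m →
      Integrable (fun x : Fin n → ℝ => Q.eval (∑ i, x i) * polyMulti P lam k x)
        (Measure.pi fun i => L (lam i)) ∧
      ∫ x, Q.eval (∑ i, x i) * polyMulti P lam k x ∂(Measure.pi fun i => L (lam i)) =
        Q.coeff m * (m.factorial * alphaMulti L P lam k) := by
    intro k hk Q hQ
    have h := integral_eval_sum_mul_prod (fun i => hLmom _ (hlam i)) (hmi k hk)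
      (fun i => hop _ (hlam i) _ (le_of_mem_multiIndices hk i)) hQ
    refine ⟨h.1, h.2.trans ?_⟩
    congr 1
    -- The integrals are `k_i! α`, and the multinomial coefficient times `∏ k_i!` is `m!`.
    have hspec := Nat.multinomial_spec Finset.univ k
    rw [hmi k hk] at hspec
    rw [← hspec, alphaMulti]
    unfold alpha
    have hfac : (∏ i, ((k i).factorial : ℝ)) ≠ 0 := Finset.prod_ne_zero_iff.2 fun i _ => by
      positivity
    simp_rw [mul_comm (_ ^ k _)]
    rw [Finset.prod_mul_distrib, Finset.prod_inv_distrib]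
    push_cast
    field_simp
  have hPdeg : (P (∑ i, lam i) m).natDegree = m := (hop _ hpos m le_rfl).natDegree_eq
  have hfac : (0 : ℝ) < m.factorial := by positivity
  -- Pair the identity with `Q = X ^ m`.
  have hconst : alpha L P (∑ i, lam i) m = ∑ k ∈ multiIndices n m, c k * alphaMulti L P lam k := by
    have hX : (Polynomial.X ^ m : ℝ[X]).natDegree ≤ m := by simp
    have hmeas : Measurable fun x : Fin n → ℝ => ∑ i, x i := by fun_prop
    have hi : ∀ k ∈ multiIndices n m, Integrable (fun x : Fin n → ℝ =>
        c k * ((Polynomial.X ^ m : ℝ[X]).eval (∑ i, x i) * polyMulti P lam k x))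
        (Measure.pi fun i => L (lam i)) := fun k hk => ((hpair k hk _ hX).1).const_mul _
    rw [alpha, hsum, integral_map hmeas.aemeasurable
      (Continuous.aestronglyMeasurable (by fun_prop))]
    have : ∀ x : Fin n → ℝ, (∑ i, x i) ^ m * (P (∑ i, lam i) m).eval (∑ i, x i) =
        ∑ k ∈ multiIndices n m,
          c k * ((Polynomial.X ^ m : ℝ[X]).eval (∑ i, x i) * polyMulti P lam k x) := fun x => by
      rw [hident, Finset.mul_sum]
      refine Finset.sum_congr rfl fun k _ => ?_
      rw [Polynomial.eval_pow, Polynomial.eval_X]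
      ring
    simp_rw [this]
    rw [integral_finsetSum _ hi, Finset.mul_sum]
    refine Finset.sum_congr rfl fun k hk => ?_
    rw [integral_const_mul, (hpair k hk _ hX).2, Polynomial.coeff_X_pow_self]
    field_simp
  -- Pair with `Q = P_λ^m`, whose top coefficient is `1`: orthogonality of the products leaves `c_k
  -- ∏ ‖P_{λ_i}^{k_i}‖² = m! ∏ α > 0`.
  have hc : ∀ k ∈ multiIndices n m, 0 ≤ c k := by
    intro k hk
    have h1 := (hpair k hk (P (∑ i, lam i) m) hPdeg.le).2
    have hmul : ∀ l : Fin n → ℕ, ∀ x : Fin n → ℝ, polyMulti P lam l x * polyMulti P lam k x =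
        ∏ i, ((P (lam i) (l i)).eval (x i) * (P (lam i) (k i)).eval (x i)) := fun l x => by
      rw [polyMulti, polyMulti, Finset.prod_mul_distrib]
    have hi : ∀ l ∈ multiIndices n m, Integrable (fun x : Fin n → ℝ =>
        c l * (polyMulti P lam l x * polyMulti P lam k x)) (Measure.pi fun i => L (lam i)) := by
      intro l hl
      simp_rw [hmul]
      refine Integrable.const_mul (Integrable.fintype_prod_dep
        (f := fun i y => (P (lam i) (l i)).eval y * (P (lam i) (k i)).eval y) fun i => ?_) _
      have hl' := le_of_mem_multiIndices hl i
      have hk' := le_of_mem_multiIndices hk i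
      have := integrable_polynomial_eval (hLmom _ (hlam i)) (Q := P (lam i) (l i) * P (lam i) (k i))
        (Polynomial.natDegree_mul_le.trans (by
          rw [(hop _ (hlam i) _ hl').natDegree_eq, (hop _ (hlam i) _ hk').natDegree_eq]; omega))
      simpa using this
    have hL : ∀ l : Fin n → ℕ, ∫ x, polyMulti P lam l x * polyMulti P lam k x
        ∂(Measure.pi fun i => L (lam i)) =
        ∏ i, ∫ y, (P (lam i) (l i)).eval y * (P (lam i) (k i)).eval y ∂(L (lam i)) := fun l => by
      simp_rw [hmul]
      exact integral_fintype_prod_eq_prod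
        (fun i y => (P (lam i) (l i)).eval y * (P (lam i) (k i)).eval y)
    simp_rw [hident, Finset.sum_mul, mul_assoc] at h1
    rw [integral_finsetSum _ hi, Finset.sum_eq_single_of_mem k hk] at h1
    · rw [integral_const_mul, hL] at h1
      have hcoeff : (P (∑ i, lam i) m).coeff m = 1 := by
        have := (hop _ hpos m le_rfl).monic.coeff_natDegree
        rwa [hPdeg] at this
      rw [hcoeff, one_mul] at h1
      have hsq : 0 < ∏ i, ∫ y, (P (lam i) (k i)).eval y * (P (lam i) (k i)).eval y ∂(L (lam i)) := by
        refine Finset.prod_pos fun i _ => ?_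
        have := (hop _ (hlam i) _ (le_of_mem_multiIndices hk i)).sq_pos
        simpa only [sq] using this
      refine (pos_of_mul_pos_left ?_ hsq.le).le
      rw [h1]
      exact mul_pos hfac (hαM k hk)
    · intro l hl hlk
      rw [integral_const_mul, hL]
      obtain ⟨i, hi⟩ := Function.ne_iff.1 hlk
      rw [Finset.prod_eq_zero (Finset.mem_univ i), mul_zero]
      exact (hP _ (hlam i)).orthogonal _ (le_of_mem_multiIndices hl i) _
        (le_of_mem_multiIndices hk i) hi
  have hαpos := hα _ hpos m le_rfl
  have hp1 : ∑ k ∈ multiIndices n m,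
      c k * (alphaMulti L P lam k / alpha L P (∑ i, lam i) m) = 1 := by
    simp_rw [← mul_div_assoc]
    rw [← Finset.sum_div, ← hconst, div_self hαpos.ne']
  refine ⟨hconst, fun k hk => mul_nonneg (hc k hk) (div_pos (hαM k hk) hαpos).le, hp1, ?_⟩
  intro Ω _ μ _ X Y I hX hXind hXmom hY hYb hYind hI hIp hIY
  have hXp : ∀ i, IsProbabilityMeasure (μ.map (X i)) := fun i =>
    Measure.isProbabilityMeasure_map (hX i).aemeasurable
  have hYp : ∀ i k, IsProbabilityMeasure (μ.map (Y i k)) := fun i k =>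
    Measure.isProbabilityMeasure_map (hY i k).aemeasurable
  have hlaw : μ.map (fun ω => ∑ i, X i ω) =
      (Measure.pi fun i => μ.map (X i)).map (fun x => ∑ i, x i) := by
    rw [← (iIndepFun_iff_map_fun_eq_pi_map fun i => (hX i).aemeasurable).1 hXind,
      Measure.map_map (by fun_prop) (by fun_prop)]
    rfl
  have hWmom : MomentsMatch m (L (∑ i, lam i)) (μ.map (fun ω => ∑ i, X i ω)) := by
    rw [hlaw, hsum]
    exact MomentsMatch.map_sum_pi (fun i => hLmom _ (hlam i)) hXmom
  have hWp : IsProbabilityMeasure (μ.map (fun ω => ∑ i, X i ω)) :=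
    Measure.isProbabilityMeasure_map (by fun_prop)
  have hopW := hop _ hpos m le_rfl
  -- `W` shares the moments of `L (∑ i, lam i)`, so `P_λ^m` is orthogonal for its law too and only
  -- the relation on exponentials remains.
  refine (hopW.of_momentsMatch hWmom).isBiased_of_charFun fun t => ?_
  have hbW : biasConst m (fun x => (P (∑ i, lam i) m).eval x) (μ.map (fun ω => ∑ i, X i ω)) =
      alpha L P (∑ i, lam i) m := hopW.biasConst_eq le_rfl hWmom (hLmom _ hpos)
  rw [hbW, charFun_map_sum_random_index hY hYind hI hIY (multiIndices n m)
    (by rw [Finset.sum_congr rfl hIp, hp1]) t]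
  have hfactor : ∀ k ∈ multiIndices n m, ∀ i,
      Integrable (fun x : ℝ => (((P (lam i) (k i)).eval x : ℝ) : ℂ) *
        Complex.exp (t * x * Complex.I)) (μ.map (X i)) ∧
      ∫ x, (((P (lam i) (k i)).eval x : ℝ) : ℂ) * Complex.exp (t * x * Complex.I) ∂(μ.map (X i)) =
        alpha L P (lam i) (k i) * (t * Complex.I) ^ k i * charFun (μ.map (Y i (k i))) t := by
    intro k hk i
    have hki := le_of_mem_multiIndices hk i
    have ho := hop _ (hlam i) _ hki
    have hint : Integrable (fun x => (P (lam i) (k i)).eval x) (μ.map (X i)) :=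
      integrable_polynomial_eval (fun j hj => (hXmom i j hj).1) (by rw [ho.natDegree_eq]; omega)
    refine ⟨integrable_mul_cexp hint t, ?_⟩
    rw [(hYb i _ hki).integral_mul_cexp hint t, ho.biasConst_eq hki (hXmom i) (hLmom _ (hlam i))]
    rfl
  have hexp : ∀ x : Fin n → ℝ, (((P (∑ i, lam i) m).eval (∑ i, x i) : ℝ) : ℂ) *
      Complex.exp (t * ((∑ i, x i : ℝ) : ℂ) * Complex.I) =
      ∑ k ∈ multiIndices n m, (c k : ℂ) * ∏ i, ((((P (lam i) (k i)).eval (x i) : ℝ) : ℂ) *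
        Complex.exp (t * x i * Complex.I)) := by
    intro x
    rw [hident, Complex.ofReal_sum, Finset.sum_mul]
    refine Finset.sum_congr rfl fun k _ => ?_
    rw [Finset.prod_mul_distrib, ← Complex.exp_sum, ← Finset.sum_mul, ← Finset.mul_sum, polyMulti]
    push_cast
    ring
  rw [hlaw, integral_map (by fun_prop) (Continuous.aestronglyMeasurable (by fun_prop))]
  simp_rw [hexp]
  rw [integral_finsetSum _ fun k hk => (Integrable.fintype_prod_dep
    (f := fun i (y : ℝ) => (((P (lam i) (k i)).eval y : ℝ) : ℂ) * Complex.exp (t * y * Complex.I))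
    fun i => (hfactor k hk i).1).const_mul _, Finset.mul_sum]
  refine Finset.sum_congr rfl fun k hk => ?_
  -- Independence factors the integral; since `|k| = m`, the powers `(it)^{k_i}` combine to
  -- `(it)^m`, and `c_k ∏ α = α_λ p_k`.
  rw [integral_const_mul, integral_fintype_prod_eq_prod
    (fun i (y : ℝ) => (((P (lam i) (k i)).eval y : ℝ) : ℂ) * Complex.exp (t * y * Complex.I)),
    Finset.prod_congr rfl fun i _ => (hfactor k hk i).2, Finset.prod_mul_distrib,
    Finset.prod_mul_distrib, Finset.prod_pow_eq_pow_sum, hmi k hk, hIp k hk, alphaMulti]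
  have hne : (alpha L P (∑ i, lam i) m : ℂ) ≠ 0 := by exact_mod_cast hαpos.ne'
  push_cast
  field_simp
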